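/- Let $n$ be a natural number and let $A,B\in\mathbb{R}^{n\times n}$. For $x\in\mathbb{R}^n$ let $|x|$ denote the entrywise absolute value, and for $s\in\{\pm1\}^n$ let $\operatorname{diag}(s)$ denote the diagonal matrix with diagonal $s$. Then the generalized absolute value equation $$Ax-B|x|=b$$ has a unique solution $x\in\mathbb{R}^n$ for every $b\in\mathbb{R}^n$ if and only if the determinants $\det(A+B\operatorname{diag}(s))$, $s\in\{\pm1\}^n$, are either all positive or all negative. -/

import Mathlib

open scoped Matrix

/-- `x` solves the generalized absolute value equation `A x - B |x| = b`, where `|x|` is the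
entrywise absolute value. -/
def IsGAVESolution {n : ℕ} (A B : Matrix (Fin n) (Fin n) ℝ) (b x : Fin n → ℝ) : Prop :=
  A *ᵥ x - B *ᵥ (fun i => |x i|) = b

/-- `s ∈ {±1}ⁿ`. -/
def IsSignVector {n : ℕ} (s : Fin n → ℝ) : Prop :=
  ∀ i, s i = 1 ∨ s i = -1

/-! Let F x = A x - B|x|. Increments of F are (A - B diag d)(x - y) with d in the cube [-1,1]ⁿ, and
every such d occurs, so F is injective exactly when no matrix A + B diag d over the cube is
singular. The determinant is affine in each d_i, so a common sign at the vertices spreads to the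
cube; conversely, nonvanishing on the connected cube forces one sign. For surjectivity, compactness
bounds the inverses over the cube uniformly. This allows continuation from the invertible A to F
along A x - t B|x|, in equal steps small enough for the contraction principle. -/

/-- Surjectivity of an expanding map is stable under small Lipschitz perturbations. -/
theorem surjective_add_of_antilipschitz {E : Type*} [NormedAddCommGroup E] [CompleteSpace E]
    {f g : E → E} {K L : ℝ} (hK : 0 ≤ K) (hL : 0 ≤ L) (hKL : K * L < 1)
    (hf : Function.Surjective f) (hfK : ∀ x y, ‖x - y‖ ≤ K * ‖f x - f y‖)
    (hg : ∀ x y, ‖g x - g y‖ ≤ L * ‖x - y‖) : Function.Surjective fun x => f x + g x := by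
  intro b
  obtain ⟨h, hh⟩ := hf.hasRightInverse
  -- A fixed point of this map satisfies f x = b - g x.
  have hφ : ContractingWith ⟨K * L, mul_nonneg hK hL⟩ fun x => h (b - g x) := by
    refine ⟨hKL, LipschitzWith.of_dist_le_mul fun x y => ?_⟩
    rw [dist_eq_norm, dist_eq_norm]
    calc ‖h (b - g x) - h (b - g y)‖ ≤ K * ‖f (h (b - g x)) - f (h (b - g y))‖ := hfK _ _
      _ = K * ‖g x - g y‖ := by rw [hh, hh, sub_sub_sub_cancel_left, norm_sub_rev]
      _ ≤ K * (L * ‖x - y‖) := by gcongr; exact hg x y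
      _ = K * L * ‖x - y‖ := by ring
  have : Nonempty E := ⟨0⟩
  refine ⟨hφ.fixedPoint, ?_⟩
  have hx := congrArg f hφ.fixedPoint_isFixedPt
  simp only [hh (b - _)] at hx
  simp only [← hx, sub_add_cancel]

/-- The difference of two absolute values is a multiple, with factor in `[-1, 1]`, of the
difference. -/
theorem exists_abs_sub_abs_eq_mul (x y : ℝ) : ∃ d ∈ Set.Icc (-1 : ℝ) 1, |x| - |y| = d * (x - y) := by
  rcases eq_or_ne x y with rfl | h
  · exact ⟨0, by norm_num, by simp⟩
  · refine ⟨(|x| - |y|) / (x - y), ?_, (div_mul_cancel₀ _ (sub_ne_zero.2 h)).symm⟩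
    rw [Set.mem_Icc, ← abs_le, abs_div]
    exact div_le_one_of_le₀ (abs_abs_sub_abs_le x y) (abs_nonneg _)

/-- Every factor in `[-1, 1]` occurs as a difference quotient of the absolute value, with any
prescribed increment. -/
theorem exists_sub_eq_and_abs_sub_abs_eq {d : ℝ} (hd : d ∈ Set.Icc (-1 : ℝ) 1) (v : ℝ) :
    ∃ x y : ℝ, x - y = v ∧ |x| - |y| = d * v := by
  obtain ⟨h1, h2⟩ := hd
  rcases le_total 0 v with hv | hv
  -- For x ≥ 0 ≥ y the conditions read x - y = v and x + y = d * v.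
  · refine ⟨(1 + d) / 2 * v, -((1 - d) / 2 * v), by ring, ?_⟩
    rw [abs_neg, abs_of_nonneg (mul_nonneg (by linarith) hv),
      abs_of_nonneg (mul_nonneg (by linarith) hv)]
    ring
  · refine ⟨(1 - d) / 2 * v, -((1 + d) / 2 * v), by ring, ?_⟩
    rw [abs_neg, abs_of_nonpos (mul_nonpos_of_nonneg_of_nonpos (by linarith) hv),
      abs_of_nonpos (mul_nonpos_of_nonneg_of_nonpos (by linarith) hv)]
    ring

section Cube

variable {n : ℕ} (A B : Matrix (Fin n) (Fin n) ℝ)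

/-- Changing one diagonal entry changes one column. -/
theorem add_mul_diagonal_update (d : Fin n → ℝ) (j : Fin n) (c : ℝ) :
    A + B * Matrix.diagonal (Function.update d j c) =
      (A + B * Matrix.diagonal d).updateCol j (fun i => A i j + c * B i j) := by
  ext i k
  rcases eq_or_ne k j with rfl | h
  · simp [Matrix.mul_diagonal, mul_comm]
  · simp [Matrix.mul_diagonal, h]

/-- The determinant is affine in each diagonal entry. -/
theorem det_add_mul_diagonal_eq (d : Fin n → ℝ) (j : Fin n) :
    (A + B * Matrix.diagonal d).det =
      (1 + d j) / 2 * (A + B * Matrix.diagonal (Function.update d j 1)).det +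
        (1 - d j) / 2 * (A + B * Matrix.diagonal (Function.update d j (-1))).det := by
  conv_lhs => rw [← Function.update_eq_self j d]
  rw [add_mul_diagonal_update, add_mul_diagonal_update, add_mul_diagonal_update,
    ← Matrix.det_updateCol_smul, ← Matrix.det_updateCol_smul, ← Matrix.det_updateCol_add]
  congr 2
  ext i
  simp only [Pi.add_apply, Pi.smul_apply, smul_eq_mul]
  ring

/-- A sign of the determinant on the vertices of the cube persists on the whole cube. -/
theorem mul_det_pos_of_forall_isSignVector {σ : ℝ}
    (h : ∀ s : Fin n → ℝ, IsSignVector s → 0 < σ * (A + B * Matrix.diagonal s).det)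
    (d : Fin n → ℝ) (hd : ∀ i, d i ∈ Set.Icc (-1 : ℝ) 1) :
    0 < σ * (A + B * Matrix.diagonal d).det := by
  -- `S` contains the coordinates allowed to leave ±1.
  suffices H : ∀ (S : Finset (Fin n)) (d : Fin n → ℝ), (∀ i, d i ∈ Set.Icc (-1 : ℝ) 1) →
      (∀ i, i ∉ S → d i = 1 ∨ d i = -1) → 0 < σ * (A + B * Matrix.diagonal d).det from
    H Finset.univ d hd fun i hi => absurd (Finset.mem_univ i) hi
  intro S
  induction S using Finset.induction_on with
  | empty => exact fun d _ hs => h d fun i => hs i (Finset.notMem_empty i)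
  | insert j S _ ih =>
    intro d hd hs
    have key : ∀ c : ℝ, c = 1 ∨ c = -1 →
        0 < σ * (A + B * Matrix.diagonal (Function.update d j c)).det := by
      intro c hc
      refine ih _ (fun i => ?_) fun i hi => ?_
      · rcases eq_or_ne i j with rfl | hij
        · rcases hc with rfl | rfl <;> simp
        · simpa [hij] using hd i
      · rcases eq_or_ne i j with rfl | hij
        · simpa using hc
        · simpa [hij] using hs i (by simp [hij, hi])
    have h1 := key 1 (Or.inl rfl)
    have h2 := key (-1) (Or.inr rfl)
    rw [det_add_mul_diagonal_eq A B d j]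
    obtain ⟨h3, h4⟩ := hd j
    rw [mul_add, mul_left_comm, mul_left_comm σ]
    -- The first weight is positive unless d j = -1, when the second is 1.
    rcases h3.lt_or_eq with h3 | h3
    · exact add_pos_of_pos_of_nonneg (mul_pos (by linarith) h1) (mul_nonneg (by linarith) h2.le)
    · rw [← h3]
      norm_num
      simpa using h2

theorem continuous_add_mul_diagonal :
    Continuous fun d : Fin n → ℝ => A + B * Matrix.diagonal d := by
  fun_prop

theorem mulVec_abs_sub_mulVec_abs {d x y : Fin n → ℝ}
    (h : ∀ i, |x i| - |y i| = d i * (x i - y i)) :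
    (B *ᵥ fun i => |x i|) - (B *ᵥ fun i => |y i|) = (B * Matrix.diagonal d) *ᵥ (x - y) := by
  rw [← Matrix.mulVec_sub, ← Matrix.mulVec_mulVec]
  congr 1
  ext i
  simp [Matrix.mulVec_diagonal, h]

/-- If the absolute value map is injective, no matrix over the cube is singular. -/
theorem det_add_mul_diagonal_ne_zero
    (hinj : Function.Injective fun x : Fin n → ℝ => A *ᵥ x - B *ᵥ fun i => |x i|)
    (d : Fin n → ℝ) (hd : ∀ i, d i ∈ Set.Icc (-1 : ℝ) 1) :
    (A + B * Matrix.diagonal d).det ≠ 0 := by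
  intro h0
  obtain ⟨v, hv, hv0⟩ := Matrix.exists_mulVec_eq_zero_iff.2 h0
  have hd' : ∀ i, -d i ∈ Set.Icc (-1 : ℝ) 1 := fun i =>
    ⟨neg_le_neg (hd i).2, by linarith [(hd i).1]⟩
  choose x y hxy habs using fun i => exists_sub_eq_and_abs_sub_abs_eq (hd' i) (v i)
  have hxv : x - y = v := funext hxy
  have hB := mulVec_abs_sub_mulVec_abs B (d := fun i => -d i) (x := x) (y := y)
    fun i => by rw [habs, hxy]
  refine hv (hxv ▸ sub_eq_zero.2 (hinj ?_))
  rw [← sub_eq_zero]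
  dsimp only
  rw [sub_sub_sub_comm, hB, ← Matrix.mulVec_sub, hxv, ← Matrix.diagonal_neg, mul_neg,
    Matrix.neg_mulVec, sub_neg_eq_add, ← Matrix.add_mulVec, hv0]

/-- A nonvanishing determinant on the cube has constant sign. -/
theorem det_pos_or_det_neg_of_forall_ne_zero
    (h : ∀ d : Fin n → ℝ, (∀ i, d i ∈ Set.Icc (-1 : ℝ) 1) →
      (A + B * Matrix.diagonal d).det ≠ 0) :
    (∀ d : Fin n → ℝ, (∀ i, d i ∈ Set.Icc (-1 : ℝ) 1) → 0 < (A + B * Matrix.diagonal d).det) ∨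
      ∀ d : Fin n → ℝ, (∀ i, d i ∈ Set.Icc (-1 : ℝ) 1) →
        (A + B * Matrix.diagonal d).det < 0 := by
  by_contra! hcon
  obtain ⟨⟨a, ha, ha'⟩, b, hb, hb'⟩ := hcon
  have hconn : IsPreconnected (Set.univ.pi fun _ : Fin n => Set.Icc (-1 : ℝ) 1) :=
    isPreconnected_univ_pi fun _ => isPreconnected_Icc
  obtain ⟨d, hd, hd0⟩ := hconn.intermediate_value (fun i _ => ha i) (fun i _ => hb i)
    (continuous_add_mul_diagonal A B).matrix_det.continuousOn ⟨ha', hb'⟩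
  exact h d (fun i => hd i trivial) hd0

open scoped Matrix.Norms.Operator in
/-- If no matrix over the cube is singular, they are uniformly bounded below. -/
theorem exists_norm_le_mul_norm_mulVec
    (h : ∀ d : Fin n → ℝ, (∀ i, d i ∈ Set.Icc (-1 : ℝ) 1) →
      (A + B * Matrix.diagonal d).det ≠ 0) :
    ∃ K : ℝ, 0 ≤ K ∧ ∀ d : Fin n → ℝ, (∀ i, d i ∈ Set.Icc (-1 : ℝ) 1) → ∀ v : Fin n → ℝ,
      ‖v‖ ≤ K * ‖(A + B * Matrix.diagonal d) *ᵥ v‖ := by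
  have hcont := continuous_add_mul_diagonal A B
  -- The inverse, written as det⁻¹ • adjugate, is continuous on the cube, hence bounded.
  have hinv : ContinuousOn (fun d => (A + B * Matrix.diagonal d).det⁻¹)
      (Set.univ.pi fun _ : Fin n => Set.Icc (-1 : ℝ) 1) :=
    hcont.matrix_det.continuousOn.inv₀ fun d hd => h d fun i => hd i trivial
  obtain ⟨K, hK⟩ := (isCompact_univ_pi fun _ : Fin n =>
    isCompact_Icc (a := (-1 : ℝ)) (b := 1)).exists_bound_of_continuousOn
      (f := fun d => (A + B * Matrix.diagonal d).det⁻¹ • (A + B * Matrix.diagonal d).adjugate)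
      (hinv.smul hcont.matrix_adjugate.continuousOn)
  refine ⟨K, (norm_nonneg _).trans (hK 0 fun i _ => by simp), fun d hd v => ?_⟩
  have hv : v = ((A + B * Matrix.diagonal d).det⁻¹ • (A + B * Matrix.diagonal d).adjugate) *ᵥ
      ((A + B * Matrix.diagonal d) *ᵥ v) := by
    rw [Matrix.mulVec_mulVec, Matrix.smul_mul, Matrix.adjugate_mul, smul_smul,
      inv_mul_cancel₀ (h d hd), one_smul, Matrix.one_mulVec]
  calc ‖v‖ = _ := congrArg norm hv
    _ ≤ _ := Matrix.linfty_opNorm_mulVec _ _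
    _ ≤ _ := by gcongr; exact hK d fun i _ => hd i

open scoped Matrix.Norms.Operator in
theorem exists_norm_mulVec_abs_sub_le :
    ∃ L : ℝ, 0 ≤ L ∧ ∀ x y : Fin n → ℝ,
      ‖(B *ᵥ fun i => |x i|) - (B *ᵥ fun i => |y i|)‖ ≤ L * ‖x - y‖ := by
  refine ⟨‖B‖, norm_nonneg _, fun x y => ?_⟩
  rw [← Matrix.mulVec_sub]
  refine (Matrix.linfty_opNorm_mulVec _ _).trans ?_
  gcongr
  exact (pi_norm_le_iff_of_nonneg (norm_nonneg _)).2 fun i =>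
    (abs_abs_sub_abs_le _ _).trans (norm_le_pi_norm (x - y) i)

/-- If no matrix over the cube is singular, the absolute value map is bijective. -/
theorem bijective_of_forall_det_ne_zero
    (h : ∀ d : Fin n → ℝ, (∀ i, d i ∈ Set.Icc (-1 : ℝ) 1) →
      (A + B * Matrix.diagonal d).det ≠ 0) :
    Function.Bijective fun x : Fin n → ℝ => A *ᵥ x - B *ᵥ fun i => |x i| := by
  obtain ⟨K, hK0, hK⟩ := exists_norm_le_mul_norm_mulVec A B h
  obtain ⟨L, hL0, hL⟩ := exists_norm_mulVec_abs_sub_le B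
  have hanti : ∀ t ∈ Set.Icc (0 : ℝ) 1, ∀ x y : Fin n → ℝ, ‖x - y‖ ≤
      K * ‖(A *ᵥ x - t • B *ᵥ fun i => |x i|) - (A *ᵥ y - t • B *ᵥ fun i => |y i|)‖ := by
    intro t ht x y
    choose d hd hxy using fun i => exists_abs_sub_abs_eq_mul (x i) (y i)
    have hmem : ∀ i, (-t • d) i ∈ Set.Icc (-1 : ℝ) 1 := by
      intro i
      rw [Set.mem_Icc, ← abs_le, Pi.smul_apply, smul_eq_mul, abs_mul, abs_neg,
        abs_of_nonneg ht.1]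
      exact mul_le_one₀ ht.2 (abs_nonneg _) (abs_le.2 (hd i))
    convert hK _ hmem (x - y) using 3
    rw [sub_sub_sub_comm, ← Matrix.mulVec_sub, ← smul_sub, mulVec_abs_sub_mulVec_abs B hxy,
      Matrix.diagonal_smul, Matrix.mul_smul, Matrix.add_mulVec, Matrix.smul_mulVec, neg_smul,
      sub_eq_add_neg]
  -- `K` does not depend on t, so the one step size 1/N, with K * L / N < 1, serves all the way from
  -- t = 0 to t = 1.
  obtain ⟨N, hN⟩ := exists_nat_gt (K * L)
  have hN0 : (0 : ℝ) < N := (mul_nonneg hK0 hL0).trans_lt hN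
  have hsurj : ∀ k : ℕ, k ≤ N → Function.Surjective fun x : Fin n → ℝ =>
      A *ᵥ x - ((k : ℝ) / N) • B *ᵥ fun i => |x i| := by
    intro k
    induction k with
    | zero =>
      intro _
      have hA : IsUnit A := by
        rw [Matrix.isUnit_iff_isUnit_det, isUnit_iff_ne_zero]
        simpa using h 0 fun i => by simp
      simpa using Matrix.mulVec_surjective_iff_isUnit.2 hA
    | succ k ih =>
      intro hk
      have hkN : (k : ℝ) ≤ N := by exact_mod_cast (Nat.le_succ k).trans hk
      convert surjective_add_of_antilipschitz
        (g := fun x : Fin n → ℝ => -((1 / N : ℝ) • B *ᵥ fun i => |x i|))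
        (L := 1 / N * L) hK0 (by positivity) ?_ (ih ((Nat.le_succ k).trans hk))
        (hanti _ ⟨by positivity, div_le_one_of_le₀ hkN hN0.le⟩) fun x y => ?_ using 2 with x
      · push_cast
        rw [add_div, add_smul, sub_add_eq_sub_sub, sub_eq_add_neg]
      · rw [← mul_assoc, mul_one_div, div_mul_eq_mul_div, div_lt_one hN0]
        exact hN
      · rw [neg_sub_neg, norm_sub_rev, ← smul_sub, norm_smul, Real.norm_of_nonneg (by positivity),
          mul_assoc]
        gcongr
        exact hL x y
  constructor
  · intro x y hxy
    have := hanti 1 (by simp) x y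
    simp only [one_smul] at this
    dsimp only at hxy
    rw [hxy, sub_self, norm_zero, mul_zero] at this
    exact sub_eq_zero.1 (norm_le_zero_iff.1 this)
  · simpa [div_self hN0.ne'] using hsurj N le_rfl

end Cube

theorem IsSignVector.mem_Icc {n : ℕ} {s : Fin n → ℝ} (hs : IsSignVector s) (i : Fin n) :
    s i ∈ Set.Icc (-1 : ℝ) 1 := by
  rcases hs i with h | h <;> simp [h]

theorem mainTheorem6 (n : ℕ) (A B : Matrix (Fin n) (Fin n) ℝ) :
    (∀ b : Fin n → ℝ, ∃! x : Fin n → ℝ, IsGAVESolution A B b x) ↔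
      ((∀ s : Fin n → ℝ, IsSignVector s → 0 < (A + B * Matrix.diagonal s).det) ∨
        (∀ s : Fin n → ℝ, IsSignVector s → (A + B * Matrix.diagonal s).det < 0)) := by
  have hbij : (∀ b : Fin n → ℝ, ∃! x : Fin n → ℝ, IsGAVESolution A B b x) ↔
      Function.Bijective fun x : Fin n → ℝ => A *ᵥ x - B *ᵥ fun i => |x i| :=
    (Function.bijective_iff_existsUnique _).symm
  rw [hbij]
  constructor
  · intro h
    exact (det_pos_or_det_neg_of_forall_ne_zero A B
      (det_add_mul_diagonal_ne_zero A B h.injective)).imp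
      (fun H s hs => H s hs.mem_Icc) (fun H s hs => H s hs.mem_Icc)
  · rintro (h | h) <;> refine bijective_of_forall_det_ne_zero A B fun d hd => ?_
    · exact right_ne_zero_of_mul (mul_det_pos_of_forall_isSignVector A B (σ := 1)
        (fun s hs => by simpa using h s hs) d hd).ne'
    · exact right_ne_zero_of_mul (mul_det_pos_of_forall_isSignVector A B (σ := -1)
        (fun s hs => by simpa using h s hs) d hd).ne'
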